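/- Let $n\ge 1$ and let $M$ be a simplicial complex (possibly infinite), in particular a triangulated $n$-manifold. A discrete ($\mathbb R^+$-valued) connection on $M$ is given by an operator $$(Q\psi)_T=\sum_{P\in T}u_{T:P}\,\psi_P ,$$ from functions of vertices to functions of $n$-simplices, with real coefficients $u_{T:P}>0$ for every $n$-simplex $T$ and every vertex $P\in T$. A thick path is a finite sequence $T_0,T_1,\dots,T_m$ of $n$-simplices such that $F_i=T_i\cap T_{i+1}$ is a common $(n-1)$-dimensional face for $0\le i<m$ and $F_i\ne F_{i+1}$ for $0\le i<m-1$; it is closed if $T_m=T_0$. For an $n$-simplex $T$ let $S_T$ be the $n$-dimensional space of functions $\psi$ on the vertices of $T$ with $(Q\psi)_T=0$; such a function is determined by its values on any $(n-1)$-face of $T$, and these values are arbitrary. Along a thick path one passes from $S_{T_i}$ to $S_{T_{i+1}}$ by restricting a solution to $F_i$ and extending the result to the unique solution in $T_{i+1}$. A closed thick path thereby defines a linear automorphism of $S_{T_0}$, its holonomy. The connection belongs to the class $SL_n^{\pm}$ (is unimodular) if the holonomy of every closed thick path has determinant $1$ or $-1$. **Theorem.** The connection $Q$ belongs to the class $SL_n^{\pm}$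 if and only if there exists a positive function $f$ on the set of $n$-simplices such that, after the gauge transformation $Q\to fQ$, i.e. $u_{T:P}\to f(T)\,u_{T:P}$, the new coefficients satisfy the following: for every pair of $n$-simplices $T',T''$ whose intersection $F=T'\cap T''$ is $(n-1)$-dimensional, $$A(T':F)=A(T'':F),\qquad\text{where } A(T:F)=\prod_{P\in F}u_{T:P}.$$ -/

import Mathlib

/-- The `n`-simplices of an abstract simplicial complex, given by their sets of `n + 1` vertices. -/
def NSimplex {V : Type*} (K : AbstractSimplicialComplex V) (n : ℕ) : Type _ :=
  {T : Finset V // T ∈ K ∧ T.card = n + 1}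

namespace NSimplex

variable {V : Type*} {K : AbstractSimplicialComplex V} {n : ℕ}

/-- The vertex set of an `n`-simplex. -/
def verts (T : NSimplex K n) : Finset V := T.1

theorem card_verts (T : NSimplex K n) : T.verts.card = n + 1 := T.2.2

end NSimplex

/-- The dual graph: its nodes are the `n`-simplices of `K`; two of them are adjacent when they
intersect in a common `(n - 1)`-dimensional face (a set of `n` vertices). -/
def dualGraph {V : Type*} [DecidableEq V] (K : AbstractSimplicialComplex V) (n : ℕ) :
    SimpleGraph (NSimplex K n) where
  Adj T T' := (T.verts ∩ T'.verts).card = n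
  symm := ⟨fun T T' h => by rw [Finset.inter_comm]; exact h⟩
  loopless := ⟨fun T h => by
    rw [Finset.inter_self, T.card_verts] at h
    omega⟩

/-- The common face `T ∩ T'` crossed by one step `(T, T')` of a path of simplices. -/
def crossedFace {V : Type*} [DecidableEq V] {K : AbstractSimplicialComplex V} {n : ℕ}
    (d : (dualGraph K n).Dart) : Finset V :=
  d.fst.verts ∩ d.snd.verts

/-- A thick path is a sequence `T₀, T₁, …, Tₘ` of `n`-simplices such that `Fᵢ = Tᵢ ∩ Tᵢ₊₁` is a common
`(n - 1)`-face and `Fᵢ ≠ Fᵢ₊₁` for all `i`. -/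
def IsThickPath {V : Type*} [DecidableEq V] {K : AbstractSimplicialComplex V} {n : ℕ}
    {T T' : NSimplex K n} (w : (dualGraph K n).Walk T T') : Prop :=
  List.IsChain (fun d e => crossedFace d ≠ crossedFace e) w.darts

/-- (The operator of) a discrete `ℝ⁺`-valued connection: a positive coefficient `u T P` for every
`n`-simplex `T` and every vertex `P` of `T`. Values `u T P` with `P ∉ T` play no role. -/
structure DiscreteConnection {V : Type*} (K : AbstractSimplicialComplex V) (n : ℕ) where
  /-- The coefficient `u_{T:P}`. -/
  u : NSimplex K n → V → ℝ
  /-- The coefficients are positive. -/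
  u_pos : ∀ (T : NSimplex K n), ∀ P ∈ T.verts, 0 < u T P

namespace DiscreteConnection

variable {V : Type*} {K : AbstractSimplicialComplex V} {n : ℕ}

/-- The gauge transformation `Q ↦ f Q` by a positive function `f` of `n`-simplices. -/
def rescale (Q : DiscreteConnection K n) (f : NSimplex K n → ℝ) (hf : ∀ T, 0 < f T) :
    DiscreteConnection K n where
  u T P := f T * Q.u T P
  u_pos T P hP := mul_pos (hf T) (Q.u_pos T P hP)

/-- `A(T:F)`: the product of the coefficients of the simplex `T` at the vertices of the face `F`. -/
def faceProd (Q : DiscreteConnection K n) (T : NSimplex K n) (F : Finset V) : ℝ :=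
  ∏ P ∈ F, Q.u T P

/-- The functional `ψ ↦ (Qψ)_T = ∑_{P ∈ T} u_{T:P} ψ_P` on functions of the vertices of `T`. -/
noncomputable def localOp (Q : DiscreteConnection K n) (T : NSimplex K n) :
    ({P // P ∈ T.verts} → ℝ) →ₗ[ℝ] ℝ :=
  ∑ P : {P // P ∈ T.verts}, Q.u T P • LinearMap.proj P

/-- The (`n`-dimensional) space of solutions of the equation `(Qψ)_T = 0` in one simplex `T`. -/
noncomputable def localSol (Q : DiscreteConnection K n) (T : NSimplex K n) :
    Submodule ℝ ({P // P ∈ T.verts} → ℝ) :=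
  LinearMap.ker (Q.localOp T)

theorem mem_localSol (Q : DiscreteConnection K n) (T : NSimplex K n)
    (ψ : {P // P ∈ T.verts} → ℝ) :
    ψ ∈ Q.localSol T ↔ ∑ P : {P // P ∈ T.verts}, Q.u T P * ψ P = 0 := by
  simp [localSol, localOp, LinearMap.mem_ker, LinearMap.sum_apply]

/-- Restriction of a solution in `T` to the vertices of a set `F` of vertices of `T`. -/
noncomputable def restrictFace (Q : DiscreteConnection K n) (T : NSimplex K n) (F : Finset V)
    (hF : F ⊆ T.verts) : Q.localSol T →ₗ[ℝ] ({P // P ∈ F} → ℝ) where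
  toFun ψ P := ψ.1 ⟨P.1, hF P.2⟩
  map_add' _ _ := rfl
  map_smul' _ _ := rfl

theorem restrictFace_bijective (Q : DiscreteConnection K n) (T : NSimplex K n) (F : Finset V)
    (hF : F ⊆ T.verts) (hcard : F.card = n) : Function.Bijective (Q.restrictFace T F hF) := by
  classical
  obtain ⟨b, hb, hT⟩ : ∃ b, b ∉ F ∧ insert b F = T.verts := by
    have h1 : (T.verts \ F).card = 1 := by
      rw [Finset.card_sdiff_of_subset hF, T.card_verts, hcard]
      omega
    obtain ⟨b, hb⟩ := Finset.card_eq_one.mp h1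
    have hb' : b ∈ T.verts \ F := by rw [hb]; exact Finset.mem_singleton_self b
    refine ⟨b, (Finset.mem_sdiff.mp hb').2, ?_⟩
    ext x
    have hx : x ∈ T.verts \ F ↔ x = b := by rw [hb, Finset.mem_singleton]
    rw [Finset.mem_sdiff] at hx
    rw [Finset.mem_insert]
    constructor
    · rintro (h | h)
      · exact (hx.mpr h).1
      · exact hF h
    · intro h
      by_cases hxF : x ∈ F
      · exact Or.inr hxF
      · exact Or.inl (hx.mp ⟨h, hxF⟩)
  have hbT : b ∈ T.verts := by rw [← hT]; exact Finset.mem_insert_self b F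
  have hub : 0 < Q.u T b := Q.u_pos T b hbT
  have key : ∀ φ : V → ℝ, ∑ P : {P // P ∈ T.verts}, Q.u T P * φ P
      = Q.u T b * φ b + ∑ P ∈ F, Q.u T P * φ P := by
    intro φ
    rw [Finset.sum_coe_sort T.verts (fun P => Q.u T P * φ P), ← hT, Finset.sum_insert hb]
  constructor
  · rw [← LinearMap.ker_eq_bot, LinearMap.ker_eq_bot']
    rintro ⟨ψ, hψ⟩ h0
    have hz : ∀ P (hP : P ∈ F), ψ ⟨P, hF hP⟩ = 0 := fun P hP => congrFun h0 ⟨P, hP⟩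
    rw [mem_localSol] at hψ
    let φ : V → ℝ := fun P => if h : P ∈ T.verts then ψ ⟨P, h⟩ else 0
    have hφ : ∀ P : {P // P ∈ T.verts}, φ P = ψ P := fun P => dif_pos P.2
    have h2 : ∑ P : {P // P ∈ T.verts}, Q.u T P * φ P = 0 := by
      rw [← hψ]
      exact Finset.sum_congr rfl fun P _ => by rw [hφ]
    have h3 : ∑ P ∈ F, Q.u T P * φ P = 0 := by
      refine Finset.sum_eq_zero fun P hP => ?_
      rw [hφ ⟨P, hF hP⟩, hz P hP, mul_zero]
    rw [key, h3, add_zero] at h2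
    have hφb : φ b = 0 := (mul_eq_zero.mp h2).resolve_left hub.ne'
    apply Subtype.ext
    funext P
    obtain ⟨P, hP⟩ := P
    have hP' := hP
    rw [← hT, Finset.mem_insert] at hP'
    rcases hP' with rfl | hPF
    · exact (hφ ⟨P, hP⟩).symm.trans hφb
    · exact hz P hPF
  · intro χ
    let φ : V → ℝ := fun P => if h : P ∈ F then χ ⟨P, h⟩ else
      -(∑ R : {R // R ∈ F}, Q.u T R * χ R) / Q.u T b
    refine ⟨⟨fun P => φ P, ?_⟩, ?_⟩
    · rw [mem_localSol, key]
      have h1 : φ b = -(∑ R : {R // R ∈ F}, Q.u T R * χ R) / Q.u T b := dif_neg hb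
      have h2 : ∑ P ∈ F, Q.u T P * φ P = ∑ R : {R // R ∈ F}, Q.u T R * χ R := by
        rw [← Finset.sum_coe_sort F (fun P => Q.u T P * φ P)]
        exact Finset.sum_congr rfl fun P _ => by
          rw [show φ P = χ P from dif_pos P.2]
      rw [h1, h2, mul_div_cancel₀ _ hub.ne', neg_add_cancel]
    · funext P
      exact dif_pos P.2

/-- Solutions in `T` correspond to arbitrary data on an `(n - 1)`-face `F` of `T`. -/
noncomputable def faceEquiv (Q : DiscreteConnection K n) (T : NSimplex K n) (F : Finset V)
    (hF : F ⊆ T.verts) (hcard : F.card = n) : Q.localSol T ≃ₗ[ℝ] ({P // P ∈ F} → ℝ) :=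
  LinearEquiv.ofBijective (Q.restrictFace T F hF) (Q.restrictFace_bijective T F hF hcard)

/-- One step of the transport: a solution in `T` is restricted to the common face `T ∩ T'`, and these
data are extended to the unique solution in `T'`. -/
noncomputable def step [DecidableEq V] (Q : DiscreteConnection K n) {T T' : NSimplex K n}
    (h : (dualGraph K n).Adj T T') : Q.localSol T ≃ₗ[ℝ] Q.localSol T' :=
  (Q.faceEquiv T (T.verts ∩ T'.verts) Finset.inter_subset_left h).trans
    (Q.faceEquiv T' (T.verts ∩ T'.verts) Finset.inter_subset_right h).symm

/-- The nonabelian transport along a path of simplices, obtained by solving `Qψ = 0` successively in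
each simplex of the path. -/
noncomputable def transport [DecidableEq V] (Q : DiscreteConnection K n) {T T' : NSimplex K n} :
    (dualGraph K n).Walk T T' → (Q.localSol T ≃ₗ[ℝ] Q.localSol T')
  | .nil => LinearEquiv.refl ℝ _
  | .cons h w => (Q.step h).trans (transport Q w)

/-- `Q` belongs to the class `SL_n^±`: the holonomy of every closed thick path has determinant
`1` or `-1`. -/
def IsUnimodular [DecidableEq V] (Q : DiscreteConnection K n) : Prop :=
  ∀ (T : NSimplex K n) (w : (dualGraph K n).Walk T T), IsThickPath w →
    LinearMap.det (Q.transport w : Q.localSol T →ₗ[ℝ] Q.localSol T) = 1 ∨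
      LinearMap.det (Q.transport w : Q.localSol T →ₗ[ℝ] Q.localSol T) = -1

end DiscreteConnection

open SimpleGraph

namespace DiscreteConnection

variable {V : Type*} {K : AbstractSimplicialComplex V} {n : ℕ}

/-! Use the values on a face as coordinates on the solution space of a simplex. Passing from face
`F` to face `G` of the same `T` has determinant `± A(T:F) / A(T:G)` (`abs_det_faceFrame_change`),
while crossing a face is the identity in the coordinates of that face. Hence the holonomy of a
closed path has absolute determinant `walkRatio`, the product of `A(Tᵢ₊₁:Fᵢ) / A(Tᵢ:Fᵢ)`
(`abs_det_transport`). Thickness costs nothing (`exists_isThickPath_walkRatio_eq`), so unimodularity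
says that this multiplicative cocycle on the dual graph is trivial on all cycles, i.e. is `g T' / g
T` for some positive `g`. A gauge change multiplies `A(T:F)` by `f T ^ n`, so `f = g ^ (-1/n)`
equalizes the two sides of every face, and `g = f ^ (-n)` gives the converse. -/

theorem faceProd_pos (Q : DiscreteConnection K n) (T : NSimplex K n) {F : Finset V}
    (hF : F ⊆ T.verts) : 0 < Q.faceProd T F :=
  Finset.prod_pos fun P hP => Q.u_pos T P (hF hP)

theorem rescale_faceProd (Q : DiscreteConnection K n) (f : NSimplex K n → ℝ) (hf : ∀ T, 0 < f T)
    (T : NSimplex K n) (F : Finset V) :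
    (Q.rescale f hf).faceProd T F = f T ^ F.card * Q.faceProd T F := by
  simp [faceProd, rescale, Finset.prod_mul_distrib]

/-! ### Change of face within one simplex. -/

/-- The coordinates on the space of solutions in `T` given by the values at the vertices of a face
`F`, in some order. -/
noncomputable def faceFrame (Q : DiscreteConnection K n) (T : NSimplex K n) (F : Finset V)
    (hF : F ⊆ T.verts) (hcard : F.card = n) : Q.localSol T ≃ₗ[ℝ] (Fin n → ℝ) :=
  (Q.faceEquiv T F hF hcard).trans
    (LinearEquiv.funCongrLeft ℝ ℝ (F.equivFinOfCardEq hcard).symm)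

theorem faceFrame_apply (Q : DiscreteConnection K n) (T : NSimplex K n) (F : Finset V)
    (hF : F ⊆ T.verts) (hcard : F.card = n) (ψ : Q.localSol T) (i : Fin n) :
    Q.faceFrame T F hF hcard ψ i
      = ψ.1 ⟨((F.equivFinOfCardEq hcard).symm i).1, hF ((F.equivFinOfCardEq hcard).symm i).2⟩ :=
  rfl

theorem exists_eq_erase {T F : Finset V} [DecidableEq V] (hF : F ⊆ T)
    (hcard : T.card = F.card + 1) : ∃ P ∈ T, F = T.erase P := by
  obtain ⟨P, hP, rfl⟩ := Finset.exists_eq_insert_iff.mpr ⟨hF, hcard.symm⟩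
  exact ⟨P, Finset.mem_insert_self P F, (Finset.erase_insert hP).symm⟩

theorem det_updateRow_one {ι : Type*} [Fintype ι] [DecidableEq ι] (k : ι) (v : ι → ℝ) :
    ((1 : Matrix ι ι ℝ).updateRow k v).det = v k := by
  rw [← Matrix.cramer_transpose_apply, Matrix.transpose_one, Matrix.cramer_one, Module.End.one_apply]

theorem abs_det_permMatrix {ι : Type*} [Fintype ι] [DecidableEq ι] (σ : Equiv.Perm ι) :
    |(σ.permMatrix ℝ).det| = 1 := by
  rw [Matrix.det_permutation]
  rcases Int.units_eq_one_or (Equiv.Perm.sign σ) with h | h <;> simp [h]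

/-- Comparison of the coordinates given by two faces of the same simplex: up to sign, the change of
coordinates has determinant `A(T:F) / A(T:G)`. -/
theorem abs_det_faceFrame_change (Q : DiscreteConnection K n) (T : NSimplex K n) {F G : Finset V}
    (hF : F ⊆ T.verts) (hFc : F.card = n) (hG : G ⊆ T.verts) (hGc : G.card = n) :
    |LinearMap.det (((Q.faceFrame T F hF hFc).symm.trans (Q.faceFrame T G hG hGc)) :
      (Fin n → ℝ) →ₗ[ℝ] (Fin n → ℝ))| * Q.faceProd T G = Q.faceProd T F := by
  classical
  obtain ⟨P, hPT, hFP⟩ := exists_eq_erase hF (by rw [hFc, T.card_verts])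
  obtain ⟨R, hRT, hGR⟩ := exists_eq_erase hG (by rw [hGc, T.card_verts])
  have memF : ∀ x, x ∈ F ↔ x ≠ P ∧ x ∈ T.verts := fun x => by rw [hFP, Finset.mem_erase]
  have memG : ∀ x, x ∈ G ↔ x ≠ R ∧ x ∈ T.verts := fun x => by rw [hGR, Finset.mem_erase]
  by_cases hPR : P = R
  · obtain rfl : F = G := by rw [hFP, hGR, hPR]
    simp
  have hRF : R ∈ F := (memF R).2 ⟨Ne.symm hPR, hRT⟩
  have huP := Q.u_pos T P hPT
  have huR := Q.u_pos T R hRT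
  let eF := F.equivFinOfCardEq hFc
  let eG := G.equivFinOfCardEq hGc
  -- `F` omits `P` and `G` omits `R`, so the swap fixes the shared vertices and sends `P` to `R`.
  let τ : {x // x ∈ G} ≃ {x // x ∈ F} := (Equiv.swap P R).subtypeEquiv fun x => by
    rw [memF, memG]
    rcases eq_or_ne x P with rfl | hxP
    · simp [hPR, hRT, Ne.symm hPR, hPT]
    rcases eq_or_ne x R with rfl | hxR
    · simp
    simp [Equiv.swap_apply_of_ne_of_ne hxP hxR, hxP, hxR]
  let π : Equiv.Perm (Fin n) := (eG.symm.trans τ).trans eF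
  -- The row expressing `ψ P` through the values on `F`; it replaces the row of `R`, at index `k`.
  let v : Fin n → ℝ := fun j => -(Q.u T (eF.symm j).1 / Q.u T P)
  let k : Fin n := eF ⟨R, hRF⟩
  have hmap : ((Q.faceFrame T F hF hFc).symm.trans (Q.faceFrame T G hG hGc) :
      (Fin n → ℝ) →ₗ[ℝ] (Fin n → ℝ)) =
      Matrix.toLin' (π.permMatrix ℝ * (1 : Matrix (Fin n) (Fin n) ℝ).updateRow k v) := by
    apply LinearMap.ext
    intro x
    obtain ⟨ψ, rfl⟩ := (Q.faceFrame T F hF hFc).surjective x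
    have hsum : v ⬝ᵥ Q.faceFrame T F hF hFc ψ = ψ.1 ⟨P, hPT⟩ := by
      have h0 := (Q.mem_localSol T ψ.1).1 ψ.2
      let φ : V → ℝ := fun x => if h : x ∈ T.verts then ψ.1 ⟨x, h⟩ else 0
      have hφ : ∀ x : {x // x ∈ T.verts}, φ x = ψ.1 x := fun x => dif_pos x.2
      have h1 : ∑ x ∈ T.verts, Q.u T x * φ x = 0 := by
        rw [← Finset.sum_coe_sort T.verts (fun x => Q.u T x * φ x), ← h0]
        exact Finset.sum_congr rfl fun x _ => by rw [hφ]
      rw [← Finset.add_sum_erase _ _ hPT, ← hFP] at h1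
      have h2 : v ⬝ᵥ Q.faceFrame T F hF hFc ψ = -(∑ x ∈ F, Q.u T x * φ x) / Q.u T P := by
        rw [← Finset.sum_coe_sort F (fun x => Q.u T x * φ x), ← Equiv.sum_comp eF.symm,
          neg_div, Finset.sum_div, ← Finset.sum_neg_distrib]
        refine Finset.sum_congr rfl fun i _ => ?_
        rw [faceFrame_apply, hφ ⟨(eF.symm i).1, hF (eF.symm i).2⟩]
        simp only [v, eF]
        ring
      rw [h2, ← hφ ⟨P, hPT⟩, div_eq_iff huP.ne']
      linarith
    rw [Matrix.toLin'_apply, ← Matrix.mulVec_mulVec, Matrix.permMatrix_mulVec,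
      Matrix.updateRow_mulVec, hsum, Matrix.one_mulVec]
    funext i
    simp only [LinearEquiv.coe_coe, LinearEquiv.trans_apply, LinearEquiv.symm_apply_apply,
      Function.comp_apply]
    rw [faceFrame_apply]
    change ψ.1 ⟨(eG.symm i).1, _⟩ = _
    have hπ : ∀ h, π i = eF ⟨Equiv.swap P R (eG.symm i).1, h⟩ := fun _ => rfl
    have hiG := (memG _).1 (eG.symm i).2
    by_cases hi : (eG.symm i).1 = P
    · have hk : π i = k := by
        rw [hπ (by rw [hi, Equiv.swap_apply_left]; exact hRF)]
        simp only [k, hi, Equiv.swap_apply_left]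
      rw [hk, Function.update_self]
      exact congrArg ψ.1 (Subtype.ext hi)
    · have hiF : (eG.symm i).1 ∈ F := (memF _).2 ⟨hi, hiG.2⟩
      have hsw := Equiv.swap_apply_of_ne_of_ne hi hiG.1
      have hπi : π i = eF ⟨(eG.symm i).1, hiF⟩ := by
        rw [hπ (by rw [hsw]; exact hiF)]
        simp only [hsw]
      have hk : π i ≠ k := by
        rw [hπi]
        intro h
        exact hiG.1 (congrArg Subtype.val (eF.injective h))
      rw [Function.update_of_ne hk, faceFrame_apply, hπi]
      refine congrArg ψ.1 (Subtype.ext ?_)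
      change _ = (eF.symm (eF _)).1
      rw [Equiv.symm_apply_apply]
  have hvk : v k = -(Q.u T R / Q.u T P) := by simp [v, k]
  -- Both sides are the product of the coefficients over all of `T`.
  have hprod : Q.u T R * Q.faceProd T G = Q.u T P * Q.faceProd T F := by
    rw [faceProd, faceProd, hFP, hGR, Finset.mul_prod_erase _ _ hRT, Finset.mul_prod_erase _ _ hPT]
  rw [hmap, LinearMap.det_toLin', Matrix.det_mul, abs_mul, abs_det_permMatrix, det_updateRow_one,
    hvk, abs_neg, abs_of_pos (div_pos huR huP), one_mul, div_mul_eq_mul_div, hprod,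
    mul_div_cancel_left₀ _ huP.ne']

/-! ### Determinant of the transport along a path. -/

variable [DecidableEq V]

/-- The product over the steps of a path of the ratios `A(Tᵢ₊₁:Fᵢ) / A(Tᵢ:Fᵢ)`, where `Fᵢ` is the
crossed face. -/
noncomputable def walkRatio (Q : DiscreteConnection K n) {T T' : NSimplex K n} :
    (dualGraph K n).Walk T T' → ℝ
  | .nil => 1
  | .cons (u := T₀) (v := T₁) _ w =>
    Q.faceProd T₁ (T₀.verts ∩ T₁.verts) / Q.faceProd T₀ (T₀.verts ∩ T₁.verts) * walkRatio Q w

theorem walkRatio_pos (Q : DiscreteConnection K n) {T T' : NSimplex K n}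
    (w : (dualGraph K n).Walk T T') : 0 < Q.walkRatio w := by
  induction w with
  | nil => exact one_pos
  | cons h w ih =>
    exact mul_pos (div_pos (Q.faceProd_pos _ Finset.inter_subset_right)
      (Q.faceProd_pos _ Finset.inter_subset_left)) ih

theorem walkRatio_append (Q : DiscreteConnection K n) {T T' T'' : NSimplex K n}
    (w : (dualGraph K n).Walk T T') (w' : (dualGraph K n).Walk T' T'') :
    Q.walkRatio (w.append w') = Q.walkRatio w * Q.walkRatio w' := by
  induction w with
  | nil => simp [walkRatio]
  | cons h w ih => rw [Walk.cons_append, walkRatio, walkRatio, ih, mul_assoc]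

/-- The determinant of the transport along a path in face coordinates, up to sign. -/
theorem abs_det_transport_faceFrame (Q : DiscreteConnection K n) {T T' : NSimplex K n}
    (w : (dualGraph K n).Walk T T') {F G : Finset V}
    (hF : F ⊆ T.verts) (hFc : F.card = n) (hG : G ⊆ T'.verts) (hGc : G.card = n) :
    |LinearMap.det (((Q.faceFrame T F hF hFc).symm.trans ((Q.transport w).trans
      (Q.faceFrame T' G hG hGc))) : (Fin n → ℝ) →ₗ[ℝ] (Fin n → ℝ))| * Q.faceProd T' G
      = Q.faceProd T F * Q.walkRatio w := by
  induction w generalizing F with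
  | nil =>
    rw [walkRatio, mul_one]
    exact Q.abs_det_faceFrame_change _ hF hFc hG hGc
  | @cons T₀ T₁ T₂ h w ih =>
    have hI := Finset.inter_subset_left (s₁ := T₀.verts) (s₂ := T₁.verts)
    have hI' := Finset.inter_subset_right (s₁ := T₀.verts) (s₂ := T₁.verts)
    have hstep : ∀ ψ, Q.step h ψ =
        (Q.faceFrame T₁ _ hI' h).symm (Q.faceFrame T₀ _ hI h ψ) := fun ψ => by
      rw [LinearEquiv.eq_symm_apply]
      simp [step, faceFrame]
    have hdecomp : ((Q.faceFrame T₀ F hF hFc).symm.trans ((Q.transport (.cons h w)).trans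
          (Q.faceFrame T₂ G hG hGc)) : (Fin n → ℝ) →ₗ[ℝ] (Fin n → ℝ)) =
        ((Q.faceFrame T₁ _ hI' h).symm.trans ((Q.transport w).trans
          (Q.faceFrame T₂ G hG hGc)) : (Fin n → ℝ) →ₗ[ℝ] (Fin n → ℝ)) ∘ₗ
        ((Q.faceFrame T₀ F hF hFc).symm.trans (Q.faceFrame T₀ _ hI h) :
          (Fin n → ℝ) →ₗ[ℝ] (Fin n → ℝ)) := by
      apply LinearMap.ext
      intro x
      simp [transport, hstep]
    have h1 := ih hI' h hG
    have h2 := Q.abs_det_faceFrame_change T₀ hF hFc hI h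
    have hpos := Q.faceProd_pos T₀ hI
    rw [hdecomp, LinearMap.det_comp, abs_mul, mul_right_comm, h1, walkRatio, ← h2]
    field_simp

/-- With the same face frame at both ends the map is a conjugate of the holonomy, and the factors
`A(T:F)` cancel. -/
theorem abs_det_transport (Q : DiscreteConnection K n) {T : NSimplex K n}
    (w : (dualGraph K n).Walk T T) :
    |LinearMap.det (Q.transport w : Q.localSol T →ₗ[ℝ] Q.localSol T)| = Q.walkRatio w := by
  obtain ⟨F, hF, hFc⟩ := Finset.exists_subset_card_eq
    (show n ≤ T.verts.card by rw [T.card_verts]; exact n.le_succ)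
  have h := Q.abs_det_transport_faceFrame w hF hFc hF hFc
  rw [mul_comm] at h
  rw [← mul_left_cancel₀ (Q.faceProd_pos T hF).ne' h, ← LinearMap.det_conj _ (Q.faceFrame T F hF hFc)]
  rfl

theorem isUnimodular_iff_walkRatio (Q : DiscreteConnection K n) :
    Q.IsUnimodular ↔ ∀ (T : NSimplex K n) (w : (dualGraph K n).Walk T T),
      IsThickPath w → Q.walkRatio w = 1 := by
  simp only [IsUnimodular, ← abs_det_transport, ← abs_eq (zero_le_one' ℝ)]

/-! ### From thick paths to a potential. -/

/-- Every path of simplices may be shortened to a thick path with the same ratio product. -/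
theorem exists_isThickPath_walkRatio_eq (Q : DiscreteConnection K n) {T T' : NSimplex K n}
    (w : (dualGraph K n).Walk T T') :
    ∃ w' : (dualGraph K n).Walk T T', IsThickPath w' ∧ Q.walkRatio w' = Q.walkRatio w := by
  induction w with
  | nil => exact ⟨.nil, List.IsChain.nil, rfl⟩
  | @cons T₀ T₁ T₃ h w ih =>
    obtain ⟨w', hw', hr⟩ := ih
    rw [walkRatio, ← hr]
    cases w' with
    | nil => exact ⟨.cons h .nil, List.IsChain.singleton _, rfl⟩
    | @cons _ T₂ _ h' w'' =>
      -- If both steps cross the same face, all three simplices contain it and the factors of `T₁`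
      -- cancel. So `T₁` is dropped: either the path backtracks, or `T₀` and `T₂` meet in that very
      -- face.
      by_cases hne : T₀.verts ∩ T₁.verts = T₁.verts ∩ T₂.verts
      · have hp₀ := Q.faceProd_pos T₀ (Finset.inter_subset_left (s₂ := T₁.verts))
        have hp₁ := Q.faceProd_pos T₁ (Finset.inter_subset_right (s₁ := T₀.verts))
        have htail : IsThickPath w'' := List.IsChain.tail hw'
        by_cases h02 : T₀ = T₂
        · subst h02
          refine ⟨w'', htail, ?_⟩
          rw [walkRatio, ← hne]
          field_simp
        · have hsub : T₀.verts ∩ T₁.verts ⊆ T₀.verts ∩ T₂.verts := fun x hx =>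
            Finset.mem_inter.2 ⟨(Finset.mem_inter.1 hx).1, (Finset.mem_inter.1 (hne ▸ hx)).2⟩
          have hle : (T₀.verts ∩ T₂.verts).card ≤ n := by
            by_contra! hlt
            have e₀ := Finset.eq_of_subset_of_card_le
              (Finset.inter_subset_left (s₁ := T₀.verts) (s₂ := T₂.verts))
              (by rw [T₀.card_verts]; exact hlt)
            have e₂ := Finset.eq_of_subset_of_card_le
              (Finset.inter_subset_right (s₁ := T₀.verts) (s₂ := T₂.verts))
              (by rw [T₂.card_verts]; exact hlt)
            exact h02 (Subtype.ext (e₀.symm.trans e₂))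
          have hface := Finset.eq_of_subset_of_card_le hsub
            (hle.trans (show (T₀.verts ∩ T₁.verts).card = n from h).ge)
          have hadj : (dualGraph K n).Adj T₀ T₂ := by
            change (T₀.verts ∩ T₂.verts).card = n
            rw [← hface]
            exact h
          refine ⟨.cons hadj w'', ?_, ?_⟩
          · cases w'' with
            | nil => exact List.IsChain.singleton _
            | cons h'' w₃ =>
              simp only [IsThickPath, Walk.darts_cons, List.isChain_cons_cons, crossedFace] at hw' ⊢
              exact ⟨by rw [← hface, hne]; exact hw'.1, hw'.2⟩
          · rw [walkRatio, walkRatio, ← hne, ← hface]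
            field_simp
      · refine ⟨.cons h (.cons h' w''), ?_, rfl⟩
        simp only [IsThickPath, Walk.darts_cons, List.isChain_cons_cons] at hw' ⊢
        exact ⟨hne, hw'⟩

theorem IsUnimodular.walkRatio_eq {Q : DiscreteConnection K n} (hQ : Q.IsUnimodular)
    {T T' : NSimplex K n} (w w' : (dualGraph K n).Walk T T') : Q.walkRatio w = Q.walkRatio w' := by
  have hclosed : ∀ w₀ : (dualGraph K n).Walk T T, Q.walkRatio w₀ = 1 := fun w₀ => by
    obtain ⟨w₁, hthick, hr⟩ := Q.exists_isThickPath_walkRatio_eq w₀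
    rw [← hr, Q.isUnimodular_iff_walkRatio.1 hQ T w₁ hthick]
  -- Closing both paths by the same return path leaves a common factor to cancel.
  have h := (hclosed (w.append w.reverse)).trans (hclosed (w'.append w.reverse)).symm
  rw [walkRatio_append, walkRatio_append] at h
  exact mul_right_cancel₀ (Q.walkRatio_pos _).ne' h

/-- A unimodular connection has a positive potential for the ratios `A(T':F) / A(T:F)`. -/
theorem IsUnimodular.exists_potential {Q : DiscreteConnection K n} (hQ : Q.IsUnimodular) :
    ∃ g : NSimplex K n → ℝ, (∀ T, 0 < g T) ∧ ∀ T T', (dualGraph K n).Adj T T' →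
      g T' * Q.faceProd T (T.verts ∩ T'.verts) = g T * Q.faceProd T' (T.verts ∩ T'.verts) := by
  -- `g` is the ratio product from a chosen base simplex of each component.
  have hroot : ∀ T, (dualGraph K n).Reachable ((dualGraph K n).connectedComponentMk T).out T :=
    fun T => ConnectedComponent.exact (Quot.out_eq _)
  refine ⟨fun T => Q.walkRatio (hroot T).some, fun T => Q.walkRatio_pos _, fun T T' h => ?_⟩
  -- Adjacent simplices have base simplices that are only provably equal, hence the separate `R` and
  -- `R'`.
  have hpath : ∀ (R R' : NSimplex K n) (_ : R' = R) (w : (dualGraph K n).Walk R T)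
      (w' : (dualGraph K n).Walk R' T'), Q.walkRatio w' * Q.faceProd T (T.verts ∩ T'.verts)
        = Q.walkRatio w * Q.faceProd T' (T.verts ∩ T'.verts) := by
    rintro R _ rfl w w'
    have hpos := Q.faceProd_pos T (Finset.inter_subset_left (s₂ := T'.verts))
    rw [hQ.walkRatio_eq w' (w.append (.cons h .nil)), walkRatio_append, walkRatio, walkRatio]
    field_simp
  exact hpath _ _ (congrArg Quot.out (ConnectedComponent.sound h.reachable).symm) _ _

theorem walkRatio_eq_of_potential (Q : DiscreteConnection K n) {g : NSimplex K n → ℝ}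
    (h : ∀ T T', (dualGraph K n).Adj T T' →
      g T' * Q.faceProd T (T.verts ∩ T'.verts) = g T * Q.faceProd T' (T.verts ∩ T'.verts))
    {T T' : NSimplex K n} (w : (dualGraph K n).Walk T T') : g T * Q.walkRatio w = g T' := by
  induction w with
  | nil => exact mul_one _
  | @cons T₀ T₁ T₂ hadj w ih =>
    have hpos := Q.faceProd_pos T₀ (Finset.inter_subset_left (s₂ := T₁.verts))
    rw [walkRatio, ← ih, ← mul_assoc, mul_div_assoc', ← h T₀ T₁ hadj, mul_div_cancel_right₀ _ hpos.ne']

end DiscreteConnection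

/-! ### The gauge function. -/

open DiscreteConnection in
theorem mainTheorem4 {V : Type*} [DecidableEq V] (K : AbstractSimplicialComplex V) (n : ℕ)
    (hn : 1 ≤ n) (Q : DiscreteConnection K n) :
    Q.IsUnimodular ↔
      ∃ (f : NSimplex K n → ℝ) (hf : ∀ T, 0 < f T),
        ∀ (T' T'' : NSimplex K n) (F : Finset V), F = T'.verts ∩ T''.verts → F.card = n →
          (Q.rescale f hf).faceProd T' F = (Q.rescale f hf).faceProd T'' F := by
  constructor
  · intro hQ
    obtain ⟨g, hg, h⟩ := hQ.exists_potential
    refine ⟨fun T => ((g T) ^ ((n : ℝ)⁻¹))⁻¹, fun T => inv_pos.2 (Real.rpow_pos_of_pos (hg T) _), ?_⟩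
    rintro T' T'' F rfl hF
    have hpow : ∀ T, (((g T) ^ ((n : ℝ)⁻¹))⁻¹) ^ n = (g T)⁻¹ := fun T => by
      rw [inv_pow, Real.rpow_inv_natCast_pow (hg T).le (Nat.one_le_iff_ne_zero.1 hn)]
    rw [rescale_faceProd, rescale_faceProd, hF, hpow, hpow]
    have h' := h T' T'' hF
    have h1 := hg T'
    have h2 := hg T''
    field_simp
    linarith
  · rintro ⟨f, hf, h⟩
    rw [isUnimodular_iff_walkRatio]
    intro T w _
    have hg : ∀ T, 0 < (f T ^ n)⁻¹ := fun T => inv_pos.2 (pow_pos (hf T) n)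
    have hpot := Q.walkRatio_eq_of_potential (g := fun T => (f T ^ n)⁻¹) (fun T T' hadj => by
      have h' := h T T' _ rfl hadj
      rw [rescale_faceProd, rescale_faceProd, show (T.verts ∩ T'.verts).card = n from hadj] at h'
      have h1 := hf T
      have h2 := hf T'
      field_simp
      linarith) w
    exact (mul_eq_left₀ (hg T).ne').1 hpot
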